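/- **Setting.** Let $\Gamma$ be a discrete group, $\lambda$ its left regular representation, and $\omega\colon\Gamma\times\Gamma\to\mathrm U(1)$ a normalized 2-cocycle, i.e. $\omega(g_0,g_1)\omega(g_0g_1,g_2)=\omega(g_1,g_2)\omega(g_0,g_1g_2)$ and $\omega(g,e)=\omega(e,g)=1$. Let $C^*_{r,\omega}(\Gamma)\subset B(\ell^2\Gamma)$ be the closed span of the operators $\lambda^{(\omega)}_g\delta_h=\omega(g,h)\delta_{gh}$, and $C^*_r(\Gamma)$ the case $\omega=1$, with coproduct $\delta(\lambda_g)=\lambda_g\otimes\lambda_g$. Let $A$ be a $C^*$-algebra (possibly non-unital), faithfully represented on a Hilbert space $H$, with a coaction $\alpha$ of $C^*_r(\Gamma)$: a $*$-homomorphism $\alpha\colon A\to C^*_r(\Gamma)\otimes A$ (minimal tensor product, on $\ell^2(\Gamma)\otimes H$) with $(\iota\otimes\alpha)\alpha=(\delta\otimes\iota)\alpha$ and with $(C^*_r(\Gamma)\otimes 1)\alpha(A)$ spanning a dense subspace of $C^*_r(\Gamma)\otimes A$. The Fell bundle associated to $A$ is $(A_g)_{g\in\Gamma}$, $A_g=\{x\in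 A:\alpha(x)=\lambda_g\otimes x\}$. **Deformation.** For $x\in C^*_{r,\bar\omega}(\Gamma)$ let $\widetilde{\mathrm{Ad}}(x)=\sum_h\delta_h\otimes\lambda^{(\bar\omega)*}_h x\lambda^{(\bar\omega)}_h$. The braided tensor product $A\boxtimes C^*_{r,\bar\omega}(\Gamma)$ is the $C^*$-algebra on $\ell^2(\Gamma)\otimes H\otimes\ell^2(\Gamma)$ generated by the operators $\alpha(a)_{12}\widetilde{\mathrm{Ad}}(x)_{13}$, $a\in A$, $x\in C^*_{r,\bar\omega}(\Gamma)$. It carries the diagonal coaction of $C^*_r(\Gamma)$, determined by $$\alpha(a)_{12}\widetilde{\mathrm{Ad}}(\lambda^{(\bar\omega)}_g)_{13}\mapsto\big((\delta\otimes\iota)\alpha(a)\big)_{123}\,\big(\lambda_g\otimes\widetilde{\mathrm{Ad}}(\lambda^{(\bar\omega)}_g)\big)_{124},$$ and the deformation $A_\omega$ is its fixed point algebra, that is, the set of $x$ which are mapped to $1\otimes x$. The coaction $\alpha_\omega$ on $A_\omega$ is the restriction of the map determined by $\alpha(a)_{12}\widetilde{\mathrm{Ad}}(x)_{13}\mapsto((\iota\otimes\alpha)\alpha(a))_{123}\widetilde{\mathrm{Ad}}(x)_{24}$,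 and the Fell bundle associated to $A_\omega$ is $((A_\omega)_g)_{g\in\Gamma}$, $(A_\omega)_g=\{x\in A_\omega:\alpha_\omega(x)=\lambda_g\otimes x\}$. **Approximation property.** A Fell bundle $(B_g)_{g\in\Gamma}$ of closed subspaces of a $C^*$-algebra has (Exel's) approximation property if there is a net $(a_i)_i$ of functions $a_i\colon\Gamma\to B_e$ such that $$\sup_i\Big\|\sum_{g}a_i(g)^*a_i(g)\Big\|<\infty,\qquad \lim_i\sum_{h}a_i(gh)^*\,b\,a_i(h)=b\quad(g\in\Gamma,\ b\in B_g),$$ the sums over $\Gamma$ being unconditionally norm convergent. **Lemma.** The Fell bundle $(A_g)_g$ associated to $A$ has the approximation property if and only if the Fell bundle $((A_\omega)_g)_g$ associated to $A_\omega$ has it. The same equivalence holds for the sequential form of the property, where the net is required to be a sequence. -/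

import Mathlib

open Filter Topology

noncomputable section

namespace FellDeformation

/-! ### The Hilbert space `ℓ²(I) ⊗ K` and operators on it -/

/-- The Hilbert space tensor product `ℓ²(I) ⊗ K`, realised as the space of square summable
functions `I → K`; the vector `δ_i ⊗ ξ` is the function with value `ξ` at `i` and `0` elsewhere. -/
def L2 (I : Type*) (K : Type*) [NormedAddCommGroup K] : Type _ := lp (fun _ : I => K) 2

section L2

variable {I J K : Type*} [NormedAddCommGroup K]

instance : NormedAddCommGroup (L2 I K) := inferInstanceAs (NormedAddCommGroup (lp (fun _ : I => K) 2))

instance [InnerProductSpace ℂ K] : InnerProductSpace ℂ (L2 I K) :=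
  inferInstanceAs (InnerProductSpace ℂ (lp (fun _ : I => K) 2))

instance [CompleteSpace K] : CompleteSpace (L2 I K) :=
  inferInstanceAs (CompleteSpace (lp (fun _ : I => K) 2))

/-- A vector of `ℓ²(I) ⊗ K` as a function `I → K`. -/
def L2.toFun (f : L2 I K) : I → K := f.1

instance : CoeFun (L2 I K) (fun _ => I → K) := ⟨L2.toFun⟩

lemma L2.ext {f g : L2 I K} (h : ∀ i, f i = g i) : f = g := lp.ext (funext h)

lemma memL2_iff {f : I → K} : Memℓp f 2 ↔ Summable fun i => ‖f i‖ ^ 2 := by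
  rw [memℓp_gen_iff (by norm_num)]
  norm_num

lemma summable_sq (f : L2 I K) : Summable fun i => ‖f i‖ ^ 2 := memL2_iff.1 (lp.memℓp f)

/-- A square summable function as a vector of `ℓ²(I) ⊗ K`. -/
def L2.mk (f : I → K) (hf : Summable fun i => ‖f i‖ ^ 2) : L2 I K :=
  (⟨f, memL2_iff.2 hf⟩ : lp (fun _ : I => K) 2)

lemma L2.mk_apply (f : I → K) (hf : Summable fun i => ‖f i‖ ^ 2) (i : I) : L2.mk f hf i = f i := rfl

lemma L2.add_apply (f g : L2 I K) (i : I) : (f + g) i = f i + g i := rfl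

lemma norm_sq_L2 (f : L2 I K) : ‖f‖ ^ 2 = ∑' i, ‖f i‖ ^ 2 := by
  have := lp.norm_rpow_eq_tsum (p := 2) (by norm_num) (show lp (fun _ : I => K) 2 from f)
  norm_num at this
  exact this

lemma flip_summable (f : L2 I (L2 J K)) :
    Summable fun p : I × J => ‖f p.1 p.2‖ ^ 2 := by
  rw [summable_prod_of_nonneg (fun _ => by positivity)]
  refine ⟨fun i => summable_sq (f i), ?_⟩
  simpa only [norm_sq_L2] using summable_sq f

lemma flip_mem (f : L2 I (L2 J K)) (j : J) : Summable fun i => ‖f i j‖ ^ 2 :=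
  (flip_summable f).prod_symm.prod_factor j

/-- The flip `ℓ²(I) ⊗ ℓ²(J) ⊗ K → ℓ²(J) ⊗ ℓ²(I) ⊗ K` as a map of vectors. -/
def flipFun (f : L2 I (L2 J K)) : L2 J (L2 I K) :=
  L2.mk (fun j => L2.mk (fun i => f i j) (flip_mem f j)) (by
    simp only [norm_sq_L2, L2.mk_apply]
    exact (flip_summable f).prod_symm.prod)

variable [InnerProductSpace ℂ K]

lemma L2.smul_apply (c : ℂ) (f : L2 I K) (i : I) : (c • f) i = c • f i := rfl

lemma inner_L2 (f g : L2 I K) : inner ℂ f g = ∑' i, inner ℂ (f i) (g i) := rfl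

/-- `(U f)(i) = U_i (f (σ⁻¹ i))` for a permutation `σ` of `I` and unitaries `U_i`, that is,
`U (δ_i ⊗ ξ) = δ_{σ i} ⊗ U_{σ i} ξ`. -/
def permUnitary (σ : Equiv.Perm I) (U : I → K ≃ₗᵢ[ℂ] K) : L2 I K ≃ₗᵢ[ℂ] L2 I K where
  toFun f := L2.mk (fun i => U i (f (σ.symm i))) (by
    simpa [Function.comp_def] using
      (σ.symm.summable_iff (f := fun i => ‖f i‖ ^ 2)).2 (summable_sq f))
  invFun f := L2.mk (fun i => (U (σ i)).symm (f (σ i))) (by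
    simpa [Function.comp_def] using (σ.summable_iff (f := fun i => ‖f i‖ ^ 2)).2 (summable_sq f))
  map_add' f g := L2.ext fun i => by simp [L2.mk_apply, L2.add_apply]
  map_smul' c f := L2.ext fun i => by simp [L2.mk_apply, L2.smul_apply]
  left_inv f := L2.ext fun i => by simp [L2.mk_apply]
  right_inv f := L2.ext fun i => by simp [L2.mk_apply]
  norm_map' f := by
    refine (sq_eq_sq₀ (norm_nonneg _) (norm_nonneg _)).1 ?_
    rw [norm_sq_L2, norm_sq_L2, ← σ.symm.tsum_eq fun i => ‖f i‖ ^ 2]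
    refine tsum_congr fun i => ?_
    exact congrArg (· ^ 2) ((U i).norm_map _)

/-- The block diagonal unitary `∑_i δ_i ⊗ U_i` on `ℓ²(I) ⊗ K`. -/
def blockDiag (U : I → K ≃ₗᵢ[ℂ] K) : L2 I K ≃ₗᵢ[ℂ] L2 I K := permUnitary (Equiv.refl I) U

/-- The flip unitary `ℓ²(I) ⊗ ℓ²(J) ⊗ K → ℓ²(J) ⊗ ℓ²(I) ⊗ K`. -/
def flip : L2 I (L2 J K) ≃ₗᵢ[ℂ] L2 J (L2 I K) where
  toFun := flipFun
  invFun := flipFun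
  map_add' _ _ := rfl
  map_smul' _ _ := rfl
  left_inv _ := rfl
  right_inv _ := rfl
  norm_map' f := by
    refine (sq_eq_sq₀ (norm_nonneg _) (norm_nonneg _)).1 ?_
    rw [norm_sq_L2, norm_sq_L2]
    simp only [norm_sq_L2]
    exact (flip_summable f).tsum_comm (f := fun i j => ‖f i j‖ ^ 2)

/-- The operator `1 ⊗ x` on `ℓ²(I) ⊗ K`, for `x` a bounded operator on `K`. -/
def ampCLM (I : Type*) (x : K →L[ℂ] K) : L2 I K →L[ℂ] L2 I K :=
  have hle : ∀ (f : L2 I K) (i : I), ‖x (f i)‖ ^ 2 ≤ ‖x‖ ^ 2 * ‖f i‖ ^ 2 := fun f i => by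
    rw [← mul_pow]
    gcongr
    exact x.le_opNorm _
  have hsum : ∀ f : L2 I K, Summable fun i => ‖x (f i)‖ ^ 2 := fun f =>
    Summable.of_nonneg_of_le (fun _ => by positivity) (hle f) ((summable_sq f).mul_left _)
  LinearMap.mkContinuous
    { toFun := fun f => L2.mk (fun i => x (f i)) (hsum f)
      map_add' := fun f g => L2.ext fun i => map_add x (f i) (g i)
      map_smul' := fun c f => L2.ext fun i => map_smul x c (f i) }
    ‖x‖ (fun f => by
      refine le_of_sq_le_sq ?_ (by positivity)
      rw [mul_pow, norm_sq_L2, norm_sq_L2, ← tsum_mul_left]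
      exact Summable.tsum_le_tsum (hle f) (hsum f) ((summable_sq f).mul_left _))

lemma flip_apply (f : L2 I (L2 J K)) (j : J) (i : I) : flip f j i = f i j := rfl

lemma flip_symm_apply (f : L2 J (L2 I K)) (i : I) (j : J) : flip.symm f i j = f j i := rfl

lemma blockDiag_apply (U : I → K ≃ₗᵢ[ℂ] K) (f : L2 I K) (i : I) :
    blockDiag U f i = U i (f i) := rfl

lemma blockDiag_symm_apply (U : I → K ≃ₗᵢ[ℂ] K) (f : L2 I K) (i : I) :
    (blockDiag U).symm f i = (U i).symm (f i) := rfl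

/-- Amplification `x ↦ 1 ⊗ x` as a unital `*`-homomorphism `B(K) → B(ℓ²(I) ⊗ K)`. -/
def amp (I K : Type*) [NormedAddCommGroup K] [InnerProductSpace ℂ K] [CompleteSpace K] :
    (K →L[ℂ] K) →⋆ₐ[ℂ] (L2 I K →L[ℂ] L2 I K) where
  toFun := ampCLM I
  map_one' := rfl
  map_mul' _ _ := rfl
  map_zero' := rfl
  map_add' _ _ := rfl
  commutes' _ := rfl
  map_star' x := by
    refine (ContinuousLinearMap.eq_adjoint_iff _ _).2 fun f g => ?_
    rw [inner_L2, inner_L2]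
    exact tsum_congr fun i => ContinuousLinearMap.adjoint_inner_left x (g i) (f i)

lemma amp_apply [CompleteSpace K] (x : K →L[ℂ] K) (f : L2 I K) (i : I) :
    amp I K x f i = x (f i) := rfl

open Classical in
/-- The map `ξ ↦ δ_t ⊗ ξ`. -/
def single (t : I) : K →L[ℂ] L2 I K := lp.singleContinuousLinearMap ℂ (fun _ : I => K) 2 t

/-- The evaluation map `f ↦ f(s)`. -/
def coord (s : I) : L2 I K →L[ℂ] K := lp.evalCLM ℂ (fun _ : I => K) 2 s

/-- The matrix entry `(s, t)` of an operator on `ℓ²(I) ⊗ K`: the operator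
`ξ ↦ (X (δ_t ⊗ ξ))(s)` on `K`. -/
def entry (s t : I) (X : L2 I K →L[ℂ] L2 I K) : K →L[ℂ] K := coord s ∘L X ∘L single t

lemma coord_apply (s : I) (f : L2 I K) : coord s f = f s := rfl

lemma single_apply [DecidableEq I] (t : I) (ξ : K) (s : I) :
    single t ξ s = if s = t then ξ else 0 := by
  classical
  obtain rfl : ‹DecidableEq I› = fun a b => Classical.propDecidable (a = b) :=
    Subsingleton.elim _ _
  have h := lp.single_apply (E := fun _ : I => K) 2 t ξ s
  rw [Pi.single_apply] at h
  exact h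

lemma entry_apply (s t : I) (X : L2 I K →L[ℂ] L2 I K) (ξ : K) :
    entry s t X ξ = X (single t ξ) s := rfl

/-- Multiplication by a complex number of modulus one, as a unitary. -/
def phase (z : Circle) : K ≃ₗᵢ[ℂ] K where
  toFun ξ := (z : ℂ) • ξ
  invFun ξ := ((z⁻¹ : Circle) : ℂ) • ξ
  map_add' := smul_add _
  map_smul' c ξ := smul_comm _ c ξ
  left_inv ξ := by simp [smul_smul]
  right_inv ξ := by simp [smul_smul]
  norm_map' ξ := by
    change ‖(z : ℂ) • ξ‖ = ‖ξ‖
    rw [norm_smul, Circle.norm_coe, one_mul]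

end L2

/-- Conjugation `x ↦ U x U*` by a unitary `U`. -/
def conjHom {E : Type*} [NormedAddCommGroup E] [InnerProductSpace ℂ E] [CompleteSpace E]
    (U : E ≃ₗᵢ[ℂ] E) : (E →L[ℂ] E) →⋆ₐ[ℂ] (E →L[ℂ] E) :=
  U.conjStarAlgEquiv.toStarAlgHom

lemma conjHom_apply {E : Type*} [NormedAddCommGroup E] [InnerProductSpace ℂ E] [CompleteSpace E]
    (U : E ≃ₗᵢ[ℂ] E) (x : E →L[ℂ] E) (ξ : E) : conjHom U x ξ = U (x (U.symm ξ)) := rfl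

/-! ### Cocycles and twisted group algebras -/

/-- Normalised `U(1)`-valued 2-cocycles on `Γ`, with values written multiplicatively. -/
structure IsTwoCocycle {Γ : Type*} [Group Γ] (ω : Γ → Γ → Circle) : Prop where
  cocycle : ∀ g₀ g₁ g₂, ω g₀ g₁ * ω (g₀ * g₁) g₂ = ω g₁ g₂ * ω g₀ (g₁ * g₂)
  right_one : ∀ g, ω g 1 = 1
  left_one : ∀ g, ω 1 g = 1

section Twisted

variable {Γ K J : Type*} [Group Γ] [NormedAddCommGroup K] [InnerProductSpace ℂ K]

/-- The unitary `λ^(ω)_g ⊗ 1` on `ℓ²(Γ) ⊗ K`, `δ_h ⊗ ξ ↦ ω(g, h) δ_{gh} ⊗ ξ`. The untwisted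
`λ_g ⊗ 1` is the case `ω = 1`. -/
def lam (ω : Γ → Γ → Circle) (g : Γ) : L2 Γ K ≃ₗᵢ[ℂ] L2 Γ K :=
  permUnitary (Equiv.mulLeft g) fun s => phase (ω g (g⁻¹ * s))

/-- The operator `λ^(ω)_g ⊗ 1` as a bounded operator. -/
def lamOp (ω : Γ → Γ → Circle) (g : Γ) : L2 Γ K →L[ℂ] L2 Γ K :=
  (lam ω g : L2 Γ K ≃ₗᵢ[ℂ] L2 Γ K).toContinuousLinearEquiv.toContinuousLinearMap

/-- The twisted reduced group `C*`-algebra `C*_{r,ω}(Γ)`, acting on the first tensor factor of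
`ℓ²(Γ) ⊗ K`: the closed linear span of the operators `λ^(ω)_g ⊗ 1`. -/
def twistedGroupAlg (ω : Γ → Γ → Circle) (K : Type*) [NormedAddCommGroup K]
    [InnerProductSpace ℂ K] : Submodule ℂ (L2 Γ K →L[ℂ] L2 Γ K) :=
  (Submodule.span ℂ (Set.range (lamOp ω))).topologicalClosure

/-- The unitary `δ_a ⊗ δ_j ⊗ ξ ↦ ω(p j, a) δ_{(p j) a} ⊗ δ_j ⊗ ξ` on `ℓ²(Γ) ⊗ ℓ²(J) ⊗ K`, that is,
`∑_j λ^(ω)_{p j} ⊗ δ_j ⊗ 1`, where `δ_j` stands for the rank one projection onto `ℂ δ_j`. -/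
def controlled (ω : Γ → Γ → Circle) (p : J → Γ) : L2 Γ (L2 J K) ≃ₗᵢ[ℂ] L2 Γ (L2 J K) :=
  (flip.trans (blockDiag fun j => lam ω (p j))).trans flip

lemma lamOp_apply (ω : Γ → Γ → Circle) (g : Γ) (f : L2 Γ K) (s : Γ) :
    lamOp ω g f s = (ω g (g⁻¹ * s) : ℂ) • f (g⁻¹ * s) := rfl

lemma controlled_apply (ω : Γ → Γ → Circle) (p : J → Γ) (f : L2 Γ (L2 J K)) (a : Γ) (j : J) :
    controlled ω p f a j = (ω (p j) ((p j)⁻¹ * a) : ℂ) • f ((p j)⁻¹ * a) j := rfl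

lemma controlled_symm_apply (ω : Γ → Γ → Circle) (p : J → Γ) (f : L2 Γ (L2 J K)) (a : Γ) (j : J) :
    (controlled ω p).symm f a j = (((ω (p j) ((p j)⁻¹ * (p j * a)))⁻¹ : Circle) : ℂ) •
      f (p j * a) j := rfl

/-- The map `δ ⊗ ι : B(ℓ²(Γ) ⊗ K) → B(ℓ²(Γ) ⊗ ℓ²(Γ) ⊗ K)`, `x ↦ Ŵ* (1 ⊗ x) Ŵ` with
`Ŵ* = ∑_h λ_h ⊗ δ_h`. It extends the coproduct `δ(λ_g) = λ_g ⊗ λ_g` of `C*_r(Γ)`. -/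
def comul (Γ K : Type*) [Group Γ] [NormedAddCommGroup K] [InnerProductSpace ℂ K]
    [CompleteSpace K] : (L2 Γ K →L[ℂ] L2 Γ K) →⋆ₐ[ℂ] (L2 Γ (L2 Γ K) →L[ℂ] L2 Γ (L2 Γ K)) :=
  (conjHom (controlled 1 id)).comp (amp Γ (L2 Γ K))

end Twisted

/-! ### Coactions of `C*_r(Γ)` -/

section Coaction

variable {Γ A H : Type*} [Group Γ] [NonUnitalCStarAlgebra A]
  [NormedAddCommGroup H] [InnerProductSpace ℂ H] [CompleteSpace H]

/-- For a `C*`-algebra `A` represented on `H` by `π`, the minimal tensor product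
`C*_r(Γ) ⊗ A ⊆ B(ℓ²(Γ) ⊗ H)`: the closed linear span of the operators `y ⊗ π(a)`. -/
def reducedTensor (Γ : Type*) [Group Γ] (π : A →⋆ₙₐ[ℂ] (H →L[ℂ] H)) :
    Submodule ℂ (L2 Γ H →L[ℂ] L2 Γ H) :=
  (Submodule.span ℂ {z | ∃ y ∈ twistedGroupAlg (1 : Γ → Γ → Circle) H, ∃ a : A,
    z = y * amp Γ H (π a)}).topologicalClosure

/-- A coaction `α : A → C*_r(Γ) ⊗ A` of `C*_r(Γ)` on a `C*`-algebra `A` that is represented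
faithfully on `H` by `π`.

The homomorphism `ι ⊗ α` on `C*_r(Γ) ⊗ A ⊆ B(ℓ²(Γ) ⊗ H)` is the entrywise application of `α` to
operator matrices indexed by `Γ` with entries in `π(A)`, so that `coassoc` says that the operators
`(δ ⊗ ι)(α(x))` and `(ι ⊗ α)(α(x))` on `ℓ²(Γ) ⊗ (ℓ²(Γ) ⊗ H)` have the same matrix entries. -/
structure Coaction (Γ : Type*) [Group Γ] (π : A →⋆ₙₐ[ℂ] (H →L[ℂ] H)) where
  /-- the underlying `*`-homomorphism -/
  toHom : A →⋆ₙₐ[ℂ] (L2 Γ H →L[ℂ] L2 Γ H)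
  mem_tensor : ∀ x, toHom x ∈ reducedTensor Γ π
  coassoc : ∀ (x : A) (s t : Γ), ∃ y : A, π y = entry s t (toHom x) ∧
    toHom y = entry s t (comul Γ H (toHom x))
  cancellation : (Submodule.span ℂ {z | ∃ y ∈ twistedGroupAlg (1 : Γ → Γ → Circle) H, ∃ a : A,
    z = y * toHom a}).topologicalClosure = reducedTensor Γ π

variable {π : A →⋆ₙₐ[ℂ] (H →L[ℂ] H)}

/-- The spectral subspace `A_g = {x ∈ A | α(x) = λ_g ⊗ x}`; the family `(A_g)_g` is the Fell
bundle associated to `A`. -/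
def Coaction.fiber (α : Coaction Γ π) (g : Γ) : Submodule ℂ A where
  carrier := {x | α.toHom x = lamOp 1 g * amp Γ H (π x)}
  zero_mem' := by simp
  add_mem' {x y} hx hy := by
    simp only [Set.mem_ofPred_eq] at hx hy ⊢
    rw [map_add, map_add, map_add, mul_add, hx, hy]
  smul_mem' c x hx := by
    simp only [Set.mem_ofPred_eq] at hx ⊢
    rw [map_smul, map_smul, map_smul, mul_smul_comm, hx]

/-! ### The braided tensor product and the deformation

The Hilbert space `ℓ²(Γ) ⊗ H ⊗ ℓ²(Γ)`, with legs numbered 1, 2, 3, is realised as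
`L2 Γ (L2 Γ H)`: the outer variable `k` is leg 3, the inner variable `h` is leg 1. Likewise
`ℓ²(Γ) ⊗ ℓ²(Γ) ⊗ H ⊗ ℓ²(Γ)` is realised as `L2 Γ (L2 Γ (L2 Γ H))` with the variables `a`, `k`, `h`
from the outside to the inside, `a` being the variable of the new leg on the left. -/

/-- The map `x_3 ↦ (W^(ω)_{13})* x_3 W^(ω)_{13}`, with `W^(ω) (δ_h ⊗ δ_k) = ω(h, k) δ_h ⊗ δ_{hk}`.
For `x ∈ C*_{r,ω}(Γ)` it is the adjoint action `∑_h (δ_h)_1 ⊗ Ad^(ω)_{h⁻¹}(x)_3`. -/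
def adTilde (ω : Γ → Γ → Circle) (H : Type*) [NormedAddCommGroup H] [InnerProductSpace ℂ H]
    [CompleteSpace H] :
    (L2 Γ (L2 Γ H) →L[ℂ] L2 Γ (L2 Γ H)) →⋆ₐ[ℂ] (L2 Γ (L2 Γ H) →L[ℂ] L2 Γ (L2 Γ H)) :=
  conjHom (controlled ω id).symm

/-- The braided tensor product `A ⊠ C*_{r,ω}(Γ)`: the `C*`-algebra on `ℓ²(Γ) ⊗ H ⊗ ℓ²(Γ)` generated
by the operators `α(a)_{12} Ãd^(ω)(x)_{13}` for `a ∈ A` and `x ∈ C*_{r,ω}(Γ)`. -/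
def Coaction.braided (α : Coaction Γ π) (ω : Γ → Γ → Circle) :
    NonUnitalStarSubalgebra ℂ (L2 Γ (L2 Γ H) →L[ℂ] L2 Γ (L2 Γ H)) :=
  (NonUnitalStarAlgebra.adjoin ℂ {z | ∃ a : A, ∃ x ∈ twistedGroupAlg ω (L2 Γ H),
    z = amp Γ (L2 Γ H) (α.toHom a) * adTilde ω H x}).topologicalClosure

/-- The diagonal coaction `α ⊗ δ_l^(ω)` of `C*_r(Γ)` on `A ⊠ C*_{r,ω}(Γ)`. It is implemented by the
unitary `∑_{h,k} λ_{hk} ⊗ δ_h ⊗ 1 ⊗ δ_k`; see `diagonalCoaction_left` and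
`diagonalCoaction_right` for its values on generators. -/
def diagonalCoaction (Γ H : Type*) [Group Γ] [NormedAddCommGroup H]
    [InnerProductSpace ℂ H] [CompleteSpace H] : (L2 Γ (L2 Γ H) →L[ℂ] L2 Γ (L2 Γ H)) →⋆ₐ[ℂ]
    (L2 Γ (L2 Γ (L2 Γ H)) →L[ℂ] L2 Γ (L2 Γ (L2 Γ H))) :=
  (conjHom ((flip.trans (blockDiag fun k : Γ => controlled 1 fun h : Γ => h * k)).trans flip)).comp
    (amp Γ (L2 Γ (L2 Γ H)))

/-- The coaction `α_ω`, `α(a)_{12} Ãd(y)_{13} ↦ ((ι ⊗ α)(α(a)))_{012} Ãd(y)_{13}`. It is implemented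
by the unitary `∑_h λ_h ⊗ δ_h ⊗ 1 ⊗ 1`; see `deformedCoaction_left` and `deformedCoaction_right`
for its values on generators. -/
def deformedCoaction (Γ H : Type*) [Group Γ] [NormedAddCommGroup H]
    [InnerProductSpace ℂ H] [CompleteSpace H] : (L2 Γ (L2 Γ H) →L[ℂ] L2 Γ (L2 Γ H)) →⋆ₐ[ℂ]
    (L2 Γ (L2 Γ (L2 Γ H)) →L[ℂ] L2 Γ (L2 Γ (L2 Γ H))) :=
  (conjHom ((flip.trans (blockDiag fun _ : Γ => controlled 1 fun h : Γ => h)).trans flip)).comp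
    (amp Γ (L2 Γ (L2 Γ H)))

/-- The inclusion `y ↦ y_{012}` of operators on legs 0, 1, 2 into operators on legs 0, 1, 2, 3. -/
def extendLeg (Γ H : Type*) [Group Γ] [NormedAddCommGroup H] [InnerProductSpace ℂ H]
    [CompleteSpace H] : (L2 Γ (L2 Γ H) →L[ℂ] L2 Γ (L2 Γ H)) →⋆ₐ[ℂ]
    (L2 Γ (L2 Γ (L2 Γ H)) →L[ℂ] L2 Γ (L2 Γ (L2 Γ H))) :=
  (LinearIsometryEquiv.conjStarAlgEquiv flip).toStarAlgHom.comp (amp Γ (L2 Γ (L2 Γ H)))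

lemma extendLeg_apply (X : L2 Γ (L2 Γ H) →L[ℂ] L2 Γ (L2 Γ H)) (f : L2 Γ (L2 Γ (L2 Γ H)))
    (a k h : Γ) : extendLeg Γ H X f a k h = X (flip f k) a h := rfl

lemma comul_apply (X : L2 Γ H →L[ℂ] L2 Γ H) (f : L2 Γ (L2 Γ H)) (a h : Γ) :
    comul Γ H X f a h = X ((controlled 1 id).symm f (h⁻¹ * a)) h := by
  simp [comul, conjHom_apply, controlled_apply, amp_apply]

lemma diagonalCoaction_apply (X : L2 Γ (L2 Γ H) →L[ℂ] L2 Γ (L2 Γ H))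
    (f : L2 Γ (L2 Γ (L2 Γ H))) (a k h : Γ) :
    diagonalCoaction Γ H X f a k h = X (((flip.trans
      (blockDiag fun k : Γ => controlled 1 fun h : Γ => h * k)).trans flip).symm f
        ((h * k)⁻¹ * a)) k h := by
  simp [diagonalCoaction, conjHom_apply, flip_apply, blockDiag_apply, controlled_apply, amp_apply]

lemma deformedCoaction_apply (X : L2 Γ (L2 Γ H) →L[ℂ] L2 Γ (L2 Γ H))
    (f : L2 Γ (L2 Γ (L2 Γ H))) (a k h : Γ) :
    deformedCoaction Γ H X f a k h = X (((flip.trans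
      (blockDiag fun _ : Γ => controlled 1 fun h : Γ => h)).trans flip).symm f (h⁻¹ * a)) k h := by
  simp [deformedCoaction, conjHom_apply, flip_apply, blockDiag_apply, controlled_apply, amp_apply]

lemma diagonalCoaction_left {X : L2 Γ H →L[ℂ] L2 Γ H} (hX : X ∈ reducedTensor Γ π) :
    diagonalCoaction Γ H (amp Γ (L2 Γ H) X) = extendLeg Γ H (comul Γ H X) := by
  have hc : ∀ φ ψ : (L2 Γ H →L[ℂ] L2 Γ H) →⋆ₐ[ℂ]
      (L2 Γ (L2 Γ (L2 Γ H)) →L[ℂ] L2 Γ (L2 Γ (L2 Γ H))),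
      IsClosed {x | φ x = ψ x} := fun φ ψ => isClosed_eq (map_continuous φ) (map_continuous ψ)
  let φ := (diagonalCoaction Γ H).comp (amp Γ (L2 Γ H))
  let ψ := (extendLeg Γ H).comp (comul Γ H)
  have hlam : ∀ g, φ (lamOp 1 g) = ψ (lamOp 1 g) := fun g => by
    ext1 f
    refine L2.ext fun a => L2.ext fun k => L2.ext fun h => ?_
    simp [φ, ψ, diagonalCoaction_apply, extendLeg_apply, comul_apply, amp_apply, lamOp_apply,
      controlled_symm_apply, flip_apply, flip_symm_apply, blockDiag_symm_apply, mul_assoc]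

  have hamp : ∀ x, φ (amp Γ H x) = ψ (amp Γ H x) := fun x => by
    ext1 f
    refine L2.ext fun a => L2.ext fun k => L2.ext fun h => ?_
    simp [φ, ψ, diagonalCoaction_apply, extendLeg_apply, comul_apply, amp_apply,
      controlled_symm_apply, flip_apply, flip_symm_apply, blockDiag_symm_apply, mul_assoc]

  have hy : ∀ y ∈ twistedGroupAlg (1 : Γ → Γ → Circle) H, φ y = ψ y := by
    refine fun y hy => closure_minimal (t := {x | φ x = ψ x}) ?_ (hc φ ψ) hy
    intro z hz
    induction hz using Submodule.span_induction with
    | mem z hz => obtain ⟨g, rfl⟩ := hz; exact hlam g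
    | zero => simp
    | add x y _ _ hx hy => simpa using congrArg₂ (· + ·) hx hy
    | smul c x _ hx => simpa using congrArg (fun T => c • T) hx
  refine closure_minimal (t := {x | φ x = ψ x}) ?_ (hc φ ψ) hX
  intro z hz
  induction hz using Submodule.span_induction with
  | mem z hz =>
    obtain ⟨y, hy', a, rfl⟩ := hz
    simpa only [map_mul, Set.mem_ofPred_eq, hamp] using congrArg (· * _) (hy y hy')
  | zero => simp
  | add x y _ _ hx hy => simpa using congrArg₂ (· + ·) hx hy
  | smul c x _ hx => simpa using congrArg (fun T => c • T) hx

lemma diagonalCoaction_right (ω : Γ → Γ → Circle) (g : Γ) :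
    diagonalCoaction Γ H (adTilde ω H (lamOp ω g)) =
      lamOp 1 g * amp Γ (L2 Γ (L2 Γ H)) (adTilde ω H (lamOp ω g)) := by
  ext1 f
  refine L2.ext fun a => L2.ext fun k => L2.ext fun h => ?_
  simp [diagonalCoaction_apply, adTilde, conjHom_apply, L2.smul_apply, amp_apply, lamOp_apply, controlled_apply,
      controlled_symm_apply, flip_symm_apply, blockDiag_symm_apply, mul_assoc]


lemma deformedCoaction_left (X : L2 Γ H →L[ℂ] L2 Γ H) :
    deformedCoaction Γ H (amp Γ (L2 Γ H) X) = extendLeg Γ H (comul Γ H X) := by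
  ext1 f
  refine L2.ext fun a => L2.ext fun k => L2.ext fun h => ?_
  rw [deformedCoaction_apply, extendLeg_apply, comul_apply, amp_apply]
  congr 2

lemma deformedCoaction_right (ω : Γ → Γ → Circle) (g : Γ) :
    deformedCoaction Γ H (adTilde ω H (lamOp ω g)) =
      amp Γ (L2 Γ (L2 Γ H)) (adTilde ω H (lamOp ω g)) := by
  ext1 f
  refine L2.ext fun a => L2.ext fun k => L2.ext fun h => ?_
  simp [deformedCoaction_apply, adTilde, conjHom_apply, L2.smul_apply, amp_apply, lamOp_apply, controlled_apply,
      controlled_symm_apply, flip_symm_apply, blockDiag_symm_apply]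

/-- The `ω`-deformation `A_ω`: the fixed point algebra of `A ⊠ C*_{r,ω̄}(Γ)` under the diagonal
coaction, where `ω̄ = ω⁻¹` is the complex conjugate cocycle. -/
def Coaction.deformation (α : Coaction Γ π) (ω : Γ → Γ → Circle) :
    NonUnitalStarSubalgebra ℂ (L2 Γ (L2 Γ H) →L[ℂ] L2 Γ (L2 Γ H)) :=
  α.braided ω⁻¹ ⊓ NonUnitalStarAlgHom.equalizer (diagonalCoaction Γ H) (amp Γ (L2 Γ (L2 Γ H)))

/-- The spectral subspace `(A_ω)_g = {x ∈ A_ω | α_ω(x) = λ_g ⊗ x}`; the family `((A_ω)_g)_g` is the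
Fell bundle associated to `A_ω`. -/
def Coaction.deformedFiber (α : Coaction Γ π) (ω : Γ → Γ → Circle) (g : Γ) :
    Submodule ℂ (L2 Γ (L2 Γ H) →L[ℂ] L2 Γ (L2 Γ H)) where
  carrier := {x | x ∈ α.deformation ω ∧
    deformedCoaction Γ H x = lamOp 1 g * amp Γ (L2 Γ (L2 Γ H)) x}
  zero_mem' := ⟨(α.deformation ω).zero_mem', by rw [map_zero, map_zero, mul_zero]⟩
  add_mem' {x y} hx hy := by
    refine ⟨(α.deformation ω).add_mem' hx.1 hy.1, ?_⟩
    rw [map_add, map_add, mul_add, hx.2, hy.2]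
  smul_mem' c x hx := by
    refine ⟨(α.deformation ω).smul_mem' c hx.1, ?_⟩
    rw [map_smul, map_smul, mul_smul_comm, hx.2]

end Coaction

/-! ### The approximation property -/

section Approximation

variable {Γ D : Type*} [Group Γ] [NonUnitalCStarAlgebra D]

/-- `(a_i)_i` is a net of functions `Γ → B_e` that witnesses the approximation property of the
Fell bundle `(B_g)_g` of subspaces of `D`. The sums over `Γ` converge unconditionally in norm. -/
structure IsApproximating (B : Γ → Submodule ℂ D) {ι : Type*} [Preorder ι] (a : ι → Γ → D) :
    Prop where
  mem : ∀ i g, a i g ∈ B 1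
  summable : ∀ i, Summable fun g => star (a i g) * a i g
  bounded : ∃ M : ℝ, ∀ i, ‖∑' g, star (a i g) * a i g‖ ≤ M
  summable_conj : ∀ g, ∀ b ∈ B g, ∀ i, Summable fun h => star (a i (g * h)) * b * a i h
  tendsto : ∀ g, ∀ b ∈ B g,
    Tendsto (fun i => ∑' h, star (a i (g * h)) * b * a i h) atTop (𝓝 b)

/-- Exel's approximation property of a Fell bundle `(B_g)_g` of subspaces of `D`: the existence of
an approximating net, indexed by a directed set in the universe `w`. -/
def HasApproximationProperty.{w, u, v} {Γ : Type u} {D : Type v} [Group Γ]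
    [NonUnitalCStarAlgebra D] (B : Γ → Submodule ℂ D) : Prop :=
  ∃ (ι : Type w) (_ : Preorder ι) (_ : IsDirectedOrder ι) (_ : Nonempty ι) (a : ι → Γ → D),
    IsApproximating B a

/-- The sequential form of the approximation property. -/
def HasSequentialApproximationProperty (B : Γ → Submodule ℂ D) : Prop :=
  ∃ a : ℕ → Γ → D, IsApproximating B a

end Approximation

end FellDeformation

end

universe w u v x

open FellDeformation

open Filter Topology

noncomputable section

/-! The approximation property sees only the Banach spaces `B g`, the products `star a * b * c` with
`a`, `c` in the unit fibre, and the products `star a * a` inside the unit fibre. Products of two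
general fibres do not enter, and these are the only ones that the cocycle changes.

For each `g` the operator `V = shiftOp ω⁻¹ H g g⁻¹`, that is `(λ_g)_1 Ãd(λ_{g⁻¹})_{13}`, is a
unitary commuting with all operators on leg 2. So `b ↦ π(b)_2 V` is isometric and intertwines left
and right multiplication by leg 2 operators; for `g = 1` it is the `*`-homomorphism `b ↦ π(b)_2`.
Once it is known to map `A_g` onto `(A_ω)_g` (`Coaction.deformedFiber_eq_map`), approximating nets
correspond one to one with the same index set (`isApproximating_iff`), which gives both forms of the
property.

Surjectivity is the main point (`Coaction.exists_fiber_of_mem_deformedFiber`). The braided tensor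
product is the closed span of operators `π(b)_2 (λ_{g'})_1 Ãd(λ_k)_{13}` with `b ∈ A_{g'}`
(`Coaction.braided_le`, resting on `Coaction.dense_fibers`). For `x ∈ (A_ω)_g`, the diagonal matrix
entries of `x V*` retain only the terms with `g' = g` and `k = g⁻¹`; hence they are all equal to one
element of `π(A_g)`. Both coactions fix `x V*`, which forces its off-diagonal entries to vanish
(`eq_midAmp_of_fixed`). Thus `x V* = π(b)_2` with `b ∈ A_g`. -/

namespace FellDeformation

/-! ### Operators on `ℓ²(I) ⊗ K` and their matrix entries -/

section Operators

variable {I K : Type*} [NormedAddCommGroup K] [InnerProductSpace ℂ K]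

lemma clm_ext_single {E : Type*} [NormedAddCommGroup E] [InnerProductSpace ℂ E]
    {X Y : L2 I K →L[ℂ] E} (h : ∀ t ξ, X (single t ξ) = Y (single t ξ)) : X = Y := by
  classical
  have : Fact ((1 : ENNReal) ≤ 2) := ⟨by norm_num⟩
  ext1 f
  have hs : HasSum (fun t => (single t (f t) : L2 I K)) f :=
    lp.hasSum_single (E := fun _ : I => K) (p := 2) (by norm_num) f
  have hX := hs.mapL X
  simp only [h] at hX
  exact hX.unique (hs.mapL Y)

lemma continuous_entry (s t : I) : Continuous (entry (K := K) s t) := by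
  unfold entry
  fun_prop

lemma entry_add (s t : I) (X Y : L2 I K →L[ℂ] L2 I K) :
    entry s t (X + Y) = entry s t X + entry s t Y := rfl

lemma entry_smul (s t : I) (c : ℂ) (X : L2 I K →L[ℂ] L2 I K) :
    entry s t (c • X) = c • entry s t X := by
  ext1 ξ; rfl

lemma entry_amp [CompleteSpace K] (s t : I) [DecidableEq I] (x : K →L[ℂ] K) :
    entry s t (amp I K x) = if s = t then x else 0 := by
  ext1 ξ
  rw [entry_apply, amp_apply, single_apply]
  split_ifs <;> simp

lemma eq_of_entry_eq {X Y : L2 I K →L[ℂ] L2 I K} (h : ∀ s t, entry s t X = entry s t Y) : X = Y :=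
  clm_ext_single fun t ξ => L2.ext fun s => congrArg (· ξ) (h s t)

/-- An injective `*`-homomorphism of `C*`-algebras is isometric, and a diagonal entry recovers `x`.
-/
lemma norm_amp [Nonempty I] [CompleteSpace K] (x : K →L[ℂ] K) : ‖amp I K x‖ = ‖x‖ := by
  classical
  refine NonUnitalStarAlgHom.norm_map (amp I K) (fun x y h => ?_) x
  obtain ⟨i⟩ := ‹Nonempty I›
  simpa [entry_amp] using congrArg (entry i i) h

end Operators

/-! ### Twisted translations and the adjoint action -/

section Twisted

variable {Γ K : Type*} [Group Γ] [NormedAddCommGroup K] [InnerProductSpace ℂ K]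
  {ω : Γ → Γ → Circle}

lemma isTwoCocycle_one : IsTwoCocycle (1 : Γ → Γ → Circle) := ⟨by simp, by simp, by simp⟩

lemma IsTwoCocycle.inv (hω : IsTwoCocycle ω) : IsTwoCocycle ω⁻¹ where
  cocycle g₀ g₁ g₂ := by simpa [mul_comm] using congrArg (·⁻¹) (hω.cocycle g₀ g₁ g₂)
  right_one g := by simp [hω.right_one]
  left_one g := by simp [hω.left_one]

lemma lamOp_mul (hω : IsTwoCocycle ω) (g h : Γ) :
    (lamOp ω g * lamOp ω h : L2 Γ K →L[ℂ] L2 Γ K) = (ω g h : ℂ) • lamOp ω (g * h) := by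
  ext1 f
  refine L2.ext fun s => ?_
  have h1 := hω.cocycle g h (h⁻¹ * (g⁻¹ * s))
  simp only [mul_inv_cancel_left] at h1
  simp only [mul_apply_eq_comp, lamOp_apply, smul_apply, L2.smul_apply,
    smul_smul, mul_inv_rev, mul_assoc, ← Circle.coe_mul, h1]
  rw [mul_comm]

lemma lamOp_one (hω : IsTwoCocycle ω) : (lamOp ω 1 : L2 Γ K →L[ℂ] L2 Γ K) = 1 := by
  ext1 f
  refine L2.ext fun s => ?_
  simp [lamOp_apply, hω.left_one]

lemma lamOp_one_mul (g h : Γ) :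
    (lamOp 1 g * lamOp 1 h : L2 Γ K →L[ℂ] L2 Γ K) = lamOp 1 (g * h) := by
  simp [lamOp_mul isTwoCocycle_one]

lemma lamOp_amp_comm [CompleteSpace K] (g : Γ) (x : K →L[ℂ] K) :
    lamOp ω g * amp Γ K x = amp Γ K x * lamOp ω g := by
  ext1 f
  refine L2.ext fun s => ?_
  simp [lamOp_apply, amp_apply]

lemma lamOp_mul_comm (hω : IsTwoCocycle ω) (k g : Γ) : ∃ c : ℂ,
    (lamOp ω k * lamOp ω g : L2 Γ K →L[ℂ] L2 Γ K) = c • (lamOp ω g * lamOp ω (g⁻¹ * k * g)) := by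
  refine ⟨ω k g * (ω g (g⁻¹ * k * g) : ℂ)⁻¹, ?_⟩
  rw [lamOp_mul hω, lamOp_mul hω, smul_smul, mul_assoc, inv_mul_cancel₀ (Circle.coe_ne_zero _),
    mul_one, mul_assoc, mul_inv_cancel_left]

variable [CompleteSpace K]

lemma star_lamOp_mul_self (g : Γ) :
    star (lamOp ω g) * lamOp ω g = (1 : L2 Γ K →L[ℂ] L2 Γ K) := by
  refine ContinuousLinearMap.ext fun f => ext_inner_left ℂ fun v => ?_
  rw [ContinuousLinearMap.star_eq_adjoint, mul_apply_eq_comp,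
    ContinuousLinearMap.adjoint_inner_right]
  exact (lam ω g).inner_map_map v f

lemma star_lamOp (hω : IsTwoCocycle ω) (g : Γ) :
    star (lamOp ω g : L2 Γ K →L[ℂ] L2 Γ K) = ((ω g g⁻¹)⁻¹ : ℂ) • lamOp ω g⁻¹ := by
  have h1 : (lamOp ω g * lamOp ω g⁻¹ : L2 Γ K →L[ℂ] L2 Γ K) = (ω g g⁻¹ : ℂ) • 1 := by
    rw [lamOp_mul hω, mul_inv_cancel, lamOp_one hω]
  calc star (lamOp ω g : L2 Γ K →L[ℂ] L2 Γ K)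
      = ((ω g g⁻¹)⁻¹ : ℂ) • (star (lamOp ω g) * (lamOp ω g * lamOp ω g⁻¹)) := by
        rw [h1, mul_smul_comm, mul_one, smul_smul, inv_mul_cancel₀ (Circle.coe_ne_zero _), one_smul]
    _ = _ := by rw [← mul_assoc, star_lamOp_mul_self, one_mul]

lemma star_lamOp_one (g : Γ) :
    star (lamOp 1 g : L2 Γ K →L[ℂ] L2 Γ K) = lamOp 1 g⁻¹ := by
  simp [star_lamOp isTwoCocycle_one]

lemma adTilde_apply (X : L2 Γ (L2 Γ K) →L[ℂ] L2 Γ (L2 Γ K)) (f : L2 Γ (L2 Γ K)) :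
    adTilde ω K X f = (controlled ω id).symm (X (controlled ω id f)) := rfl

/-- `Ãd` conjugates by `δ_h ⊗ δ_s ↦ ω(h, s) δ_h ⊗ δ_{hs}`. Translating both legs by `g` between this
map and its inverse turns `(h, s)` into `(gh, s)`, with phase `ω(h, s) ω(g, hs) / (ω(g, h) ω(gh,
s))`, which is 1 by the cocycle identity. As `(λ_g)_1` is now a value of `Ãd`, its commutation with
`Ãd(λ_k)` can be computed before `Ãd` is applied. -/
lemma adTilde_lamOp_mul_amp (hω : IsTwoCocycle ω) (g : Γ) :
    adTilde ω K (lamOp ω g * amp Γ (L2 Γ K) (lamOp ω⁻¹ g)) = amp Γ (L2 Γ K) (lamOp 1 g) := by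
  ext1 f
  refine L2.ext fun s => L2.ext fun h => ?_
  have h1 := hω.cocycle g (g⁻¹ * h) s
  simp only [mul_inv_cancel_left] at h1
  have h2 : (ω h s)⁻¹ * (ω g (g⁻¹ * (h * s)) * ((ω g (g⁻¹ * h))⁻¹ * ω (g⁻¹ * h) s)) = 1 := by
    rw [← mul_assoc g⁻¹, mul_left_comm (ω g (g⁻¹ * h * s)), mul_comm (ω g (g⁻¹ * h * s)), ← h1]
    simp
  simp only [adTilde_apply, mul_apply_eq_comp, controlled_symm_apply, controlled_apply, lamOp_apply,
    amp_apply, L2.smul_apply, smul_smul, id, mul_assoc, ← Circle.coe_mul, Pi.inv_apply,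
    mul_inv_rev, inv_inv, inv_mul_cancel_left, mul_inv_cancel_left, h2]
  simp

/-- The operators `(λ_g)_1` and `Ãd(λ^(ω)_k)_{13}` commute up to a phase and conjugation of `k`. -/
lemma adTilde_mul_amp_lamOp (hω : IsTwoCocycle ω) (k g : Γ) : ∃ c : ℂ,
    adTilde ω K (lamOp ω k) * amp Γ (L2 Γ K) (lamOp 1 g) =
      c • (amp Γ (L2 Γ K) (lamOp 1 g) * adTilde ω K (lamOp ω (g⁻¹ * k * g))) := by
  obtain ⟨c, hc⟩ := lamOp_mul_comm (K := L2 Γ K) hω k g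
  refine ⟨c, ?_⟩
  rw [← adTilde_lamOp_mul_amp hω, ← map_mul, ← map_mul, ← map_smul, mul_assoc (lamOp ω g),
    ← lamOp_amp_comm, ← mul_assoc, ← mul_assoc, hc, smul_mul_assoc]

end Twisted

/-! ### The unitaries `(λ_g)_1 Ãd(λ_k)_{13}` and operators fixed by both coactions -/

section Shift

variable {Γ H : Type*} [Group Γ] [NormedAddCommGroup H] [InnerProductSpace ℂ H] [CompleteSpace H]
  {ω : Γ → Γ → Circle}

/-- The unitary `(λ_g)_1 Ãd^(ω)(λ^(ω)_k)_{13}` on `ℓ²(Γ) ⊗ H ⊗ ℓ²(Γ)`. -/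
def shiftOp (ω : Γ → Γ → Circle) (H : Type*) [NormedAddCommGroup H] [InnerProductSpace ℂ H]
    [CompleteSpace H] (g k : Γ) : L2 Γ (L2 Γ H) →L[ℂ] L2 Γ (L2 Γ H) :=
  amp Γ (L2 Γ H) (lamOp 1 g) * adTilde ω H (lamOp ω k)

/-- The operator `x_2` on `ℓ²(Γ) ⊗ H ⊗ ℓ²(Γ)`, for `x` an operator on `H`. -/
def midAmp (Γ H : Type*) [NormedAddCommGroup H] [InnerProductSpace ℂ H] [CompleteSpace H] :
    (H →L[ℂ] H) →⋆ₐ[ℂ] (L2 Γ (L2 Γ H) →L[ℂ] L2 Γ (L2 Γ H)) :=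
  (amp Γ (L2 Γ H)).comp (amp Γ H)

omit [Group Γ] in
lemma midAmp_apply (x : H →L[ℂ] H) (f : L2 Γ (L2 Γ H)) (s h : Γ) :
    midAmp Γ H x f s h = x (f s h) := rfl

lemma norm_midAmp (x : H →L[ℂ] H) : ‖midAmp Γ H x‖ = ‖x‖ := by
  simp [midAmp, norm_amp]

lemma shiftOp_apply (g k : Γ) (f : L2 Γ (L2 Γ H)) (s h : Γ) : ∃ c : ℂ,
    shiftOp ω H g k f s h = c • f ((g⁻¹ * h)⁻¹ * (k⁻¹ * (g⁻¹ * h * s))) (g⁻¹ * h) := by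
  simp only [shiftOp, mul_apply_eq_comp, amp_apply, lamOp_apply, adTilde_apply,
    controlled_symm_apply, L2.smul_apply, controlled_apply, smul_smul, id]
  exact ⟨_, rfl⟩

lemma shiftOp_one (hω : IsTwoCocycle ω) : shiftOp ω H (1 : Γ) 1 = 1 := by
  simp [shiftOp, lamOp_one hω, lamOp_one isTwoCocycle_one]

/-- The value of the phase is left open: spectral subspaces absorb scalars, and vanishing of entries
does not depend on them. -/
lemma shiftOp_mul (hω : IsTwoCocycle ω) (g k g' k' : Γ) : ∃ c : ℂ,
    shiftOp ω H g k * shiftOp ω H g' k' =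
      c • shiftOp ω H (g * g') (g'⁻¹ * k * g' * k') := by
  obtain ⟨c, hc⟩ := adTilde_mul_amp_lamOp (K := H) hω k g'
  refine ⟨c * ω (g'⁻¹ * k * g') k', ?_⟩
  calc shiftOp ω H g k * shiftOp ω H g' k'
      = amp Γ (L2 Γ H) (lamOp 1 g) * (adTilde ω H (lamOp ω k) * amp Γ (L2 Γ H) (lamOp 1 g')) *
          adTilde ω H (lamOp ω k') := by simp only [shiftOp, mul_assoc]
    _ = c • (amp Γ (L2 Γ H) (lamOp 1 g * lamOp 1 g') *
          adTilde ω H (lamOp ω (g'⁻¹ * k * g') * lamOp ω k')) := by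
        rw [hc]; simp only [map_mul, mul_assoc, mul_smul_comm, smul_mul_assoc]
    _ = _ := by
        rw [lamOp_one_mul, lamOp_mul hω, map_smul, mul_smul_comm, smul_smul]; rfl

lemma star_shiftOp_mul_self (g k : Γ) : star (shiftOp ω H g k) * shiftOp ω H g k = 1 := by
  rw [shiftOp, star_mul, mul_assoc, ← mul_assoc (star (amp Γ (L2 Γ H) _)), ← map_star, ← map_star,
    ← map_mul, star_lamOp_mul_self, map_one, one_mul, ← map_mul, star_lamOp_mul_self, map_one]

lemma star_shiftOp (hω : IsTwoCocycle ω) (g k : Γ) : ∃ c : ℂ,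
    star (shiftOp ω H g k) = c • shiftOp ω H g⁻¹ (g * k⁻¹ * g⁻¹) := by
  obtain ⟨c, hc⟩ := adTilde_mul_amp_lamOp (K := H) hω k⁻¹ g⁻¹
  refine ⟨(ω k k⁻¹ : ℂ)⁻¹ * c, ?_⟩
  rw [shiftOp, star_mul, ← map_star, ← map_star, star_lamOp_one, star_lamOp hω, map_smul,
    smul_mul_assoc, hc, smul_smul, inv_inv, shiftOp]

lemma shiftOp_mul_star_self (hω : IsTwoCocycle ω) (g k : Γ) :
    shiftOp ω H g k * star (shiftOp ω H g k) = 1 := by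
  obtain ⟨c, hc⟩ := star_shiftOp (H := H) hω g k
  obtain ⟨d, hd⟩ := shiftOp_mul (H := H) hω g k g⁻¹ (g * k⁻¹ * g⁻¹)
  have h1 : shiftOp ω H g k * star (shiftOp ω H g k) = (c * d) • 1 := by
    rw [hc, mul_smul_comm, hd, smul_smul]
    simp [mul_assoc, shiftOp_one hω]
  -- The scalar `c * d` is not computed. Conjugation turns `V V* = (c * d) • 1` into `1 = (c * d) •
  -- 1`, because `V* V = 1`.
  have h2 := congrArg (star (shiftOp ω H g k) * · * shiftOp ω H g k) h1
  simp only [mul_assoc, star_shiftOp_mul_self, mul_one, mul_smul_comm, smul_mul_assoc] at h2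
  rw [h1, ← h2]

lemma shiftOp_comm (g k : Γ) (x : H →L[ℂ] H) :
    shiftOp ω H g k * midAmp Γ H x = midAmp Γ H x * shiftOp ω H g k := by
  have h1 : adTilde ω H (lamOp ω k) * midAmp Γ H x = midAmp Γ H x * adTilde ω H (lamOp ω k) := by
    ext1 f
    refine L2.ext fun s => L2.ext fun h => ?_
    simp [adTilde_apply, controlled_symm_apply, controlled_apply, lamOp_apply, midAmp_apply,
      L2.smul_apply]
  rw [shiftOp, mul_assoc, h1, ← mul_assoc, ← mul_assoc]
  simp only [midAmp, StarAlgHom.comp_apply, ← map_mul, lamOp_amp_comm]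

lemma star_shiftOp_comm (g k : Γ) (x : H →L[ℂ] H) :
    star (shiftOp ω H g k) * midAmp Γ H x = midAmp Γ H x * star (shiftOp ω H g k) := by
  have := congrArg star (shiftOp_comm (ω := ω) g k (star x))
  simpa [map_star] using this.symm

lemma norm_midAmp_mul_shiftOp (hω : IsTwoCocycle ω) (x : H →L[ℂ] H) (g k : Γ) :
    ‖midAmp Γ H x * shiftOp ω H g k‖ = ‖x‖ := by
  rw [← norm_midAmp (Γ := Γ) x]
  exact CStarRing.norm_mul_mem_unitary _
    (Unitary.mem_iff.2 ⟨star_shiftOp_mul_self g k, shiftOp_mul_star_self hω g k⟩)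

omit [Group Γ] in
lemma entry_midAmp_mul (s h : Γ) (x : H →L[ℂ] H) (X : L2 Γ (L2 Γ H) →L[ℂ] L2 Γ (L2 Γ H)) :
    entry h h (entry s s (midAmp Γ H x * X)) = x * entry h h (entry s s X) := rfl

/-- Up to phases, `Ãd(λ_k)` moves `(h, s)` to `(h, h⁻¹khs)` and `(λ_g)_1` then moves `h` to `gh`. A
basis position is fixed only if `g = 1` and `k = 1`. -/
lemma entry_shiftOp (g k : Γ) (hgk : ¬ (g = 1 ∧ k = 1)) (s h : Γ) :
    entry h h (entry s s (shiftOp ω H g k)) = 0 := by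
  classical
  ext1 ξ
  obtain ⟨c, hc⟩ := shiftOp_apply (ω := ω) g k (single s (single h ξ)) s h
  rw [entry_apply, entry_apply, hc, single_apply]
  split_ifs with h1
  · rw [single_apply, if_neg, smul_zero, zero_apply]
    intro h2
    have hg : g = 1 := by simpa using h2
    refine hgk ⟨hg, ?_⟩
    subst hg
    rw [inv_mul_eq_iff_eq_mul] at h1
    simpa using h1
  · exact smul_zero c

lemma shiftOp_mul_star (hω : IsTwoCocycle ω) (g' k g j : Γ) : ∃ c : ℂ,
    shiftOp ω H g' k * star (shiftOp ω H g j) = c • shiftOp ω H (g' * g⁻¹) (g * k * j⁻¹ * g⁻¹) := by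
  obtain ⟨c, hc⟩ := star_shiftOp (H := H) hω g j
  obtain ⟨d, hd⟩ := shiftOp_mul (H := H) hω g' k g⁻¹ (g * j⁻¹ * g⁻¹)
  refine ⟨c * d, ?_⟩
  rw [hc, mul_smul_comm, hd, smul_smul]
  congr 2
  group

/-- The diagonal matrix entries of `(λ_{g'})_1 Ãd(λ_k)_{13} ((λ_g)_1 Ãd(λ_j)_{13})*` vanish unless
`g' = g` and `k = j`. -/
lemma entry_shiftOp_mul_star (hω : IsTwoCocycle ω) (g' k g j s h : Γ)
    (hne : ¬ (g' = g ∧ k = j)) :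
    entry h h (entry s s (shiftOp ω H g' k * star (shiftOp ω H g j))) = 0 := by
  obtain ⟨c, hc⟩ := shiftOp_mul_star (H := H) hω g' k g j
  rw [hc, entry_smul, entry_smul, entry_shiftOp, smul_zero]
  rintro ⟨h1, h2⟩
  refine hne ⟨mul_inv_eq_one.1 h1, ?_⟩
  rw [mul_inv_eq_one, mul_assoc, mul_eq_left, mul_inv_eq_one] at h2
  exact h2

lemma diagonalCoaction_midAmp (x : H →L[ℂ] H) :
    diagonalCoaction Γ H (midAmp Γ H x) = amp Γ _ (midAmp Γ H x) := by
  ext1 f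
  refine L2.ext fun a => L2.ext fun k => L2.ext fun h => ?_
  simp [diagonalCoaction_apply, amp_apply, midAmp_apply, controlled_symm_apply, flip_symm_apply,
    blockDiag_symm_apply, mul_assoc]

lemma deformedCoaction_midAmp (x : H →L[ℂ] H) :
    deformedCoaction Γ H (midAmp Γ H x) = amp Γ _ (midAmp Γ H x) := by
  ext1 f
  refine L2.ext fun a => L2.ext fun k => L2.ext fun h => ?_
  simp [deformedCoaction_apply, amp_apply, midAmp_apply, controlled_symm_apply, flip_symm_apply,
    blockDiag_symm_apply]

/-- The factor `(λ_g)_1` contributes `λ_g` on the new leg and `Ãd(λ_{g⁻¹})` contributes `λ_{g⁻¹}`;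
they cancel. This is the reason for pairing `g` with `g⁻¹`. -/
lemma diagonalCoaction_shiftOp (g : Γ) :
    diagonalCoaction Γ H (shiftOp ω H g g⁻¹) = amp Γ _ (shiftOp ω H g g⁻¹) := by
  have h1 : diagonalCoaction Γ H (amp Γ (L2 Γ H) (lamOp 1 g)) =
      amp Γ _ (amp Γ (L2 Γ H) (lamOp 1 g)) * lamOp 1 g := by
    ext1 f
    refine L2.ext fun a => L2.ext fun k => L2.ext fun h => ?_
    simp [diagonalCoaction_apply, amp_apply, lamOp_apply, controlled_symm_apply, flip_symm_apply,
      blockDiag_symm_apply, mul_assoc]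
  rw [shiftOp, map_mul, h1, diagonalCoaction_right, mul_assoc, ← mul_assoc (lamOp 1 g),
    lamOp_one_mul, mul_inv_cancel, lamOp_one isTwoCocycle_one, one_mul, ← map_mul]

lemma deformedCoaction_shiftOp (g k : Γ) :
    deformedCoaction Γ H (shiftOp ω H g k) = lamOp 1 g * amp Γ _ (shiftOp ω H g k) := by
  have h1 : deformedCoaction Γ H (amp Γ (L2 Γ H) (lamOp 1 g)) =
      lamOp 1 g * amp Γ _ (amp Γ (L2 Γ H) (lamOp 1 g)) := by
    ext1 f
    refine L2.ext fun a => L2.ext fun k => L2.ext fun h => ?_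
    simp [deformedCoaction_apply, amp_apply, lamOp_apply, controlled_symm_apply, flip_symm_apply,
      blockDiag_symm_apply, mul_assoc]
  rw [shiftOp, map_mul, h1, deformedCoaction_right, mul_assoc, ← map_mul]

/-- Conjugation by `∑ λ_{p k h} ⊗ δ_h ⊗ 1 ⊗ δ_k` attaches the translation by `p s h * (p t k)⁻¹` to
the entry of `y` from position `(t, k)` to position `(s, h)`. If the result is `1 ⊗ y`, an entry
with a nontrivial translation must be zero. -/
lemma entry_eq_zero_of_conj_amp_eq (p : Γ → Γ → Γ) {y : L2 Γ (L2 Γ H) →L[ℂ] L2 Γ (L2 Γ H)}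
    (hy : conjHom ((flip.trans (blockDiag fun k : Γ => controlled 1 (p k))).trans flip)
      (amp Γ (L2 Γ (L2 Γ H)) y) = amp Γ _ y) {s t h k : Γ} (hne : p t k ≠ p s h) :
    entry h k (entry s t y) = 0 := by
  classical
  ext1 ξ
  set U : L2 Γ (L2 Γ (L2 Γ H)) ≃ₗᵢ[ℂ] L2 Γ (L2 Γ (L2 Γ H)) :=
    (flip.trans (blockDiag fun k : Γ => controlled 1 (p k))).trans flip with hU
  set f : L2 Γ (L2 Γ (L2 Γ H)) := single 1 (single t (single k ξ)) with hf
  have hUf : U f = single (p t k) (single t (single k ξ)) := by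
    refine L2.ext fun a => L2.ext fun b => L2.ext fun c => ?_
    have h1 : U f a b c = f ((p b c)⁻¹ * a) b c := by
      simp [hU, flip_apply, blockDiag_apply, controlled_apply]
    have h0 : ∀ u v, (0 : L2 Γ (L2 Γ H)) u v = 0 := fun _ _ => rfl
    have h0' : ∀ v, (0 : L2 Γ H) v = 0 := fun _ => rfl
    rw [h1, hf]
    simp only [single_apply, inv_mul_eq_one]
    by_cases hb : b = t
    · by_cases hc : c = k
      · subst hb hc
        simp only [eq_comm]
      · split_ifs <;> simp [h0, single_apply, hb, hc]
    · split_ifs <;> simp [h0, h0', single_apply, hb]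
  -- At coordinate `p t k` of the new leg the right side is the entry of `y` applied to `ξ`. The
  -- left side reads `f` at `(p s h)⁻¹ * p t k ≠ 1`, where `f` vanishes.
  have h2 : U (amp Γ _ y f) (p t k) s h = amp Γ _ y (U f) (p t k) s h := by
    have := congrArg (fun X => X (U f)) hy
    simp only [conjHom_apply, LinearIsometryEquiv.symm_apply_apply] at this
    rw [this]
  have h3 : U (amp Γ _ y f) (p t k) s h = y (f ((p s h)⁻¹ * p t k)) s h := by
    simp [hU, flip_apply, blockDiag_apply, controlled_apply, amp_apply]
  rw [h3, amp_apply, hUf, hf, single_apply, single_apply, if_pos rfl,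
    if_neg fun h => hne (inv_mul_eq_one.1 h).symm, map_zero] at h2
  rw [entry_apply, entry_apply]
  exact h2.symm

/-- An operator fixed by both coactions is block diagonal. -/
lemma entry_eq_zero_of_fixed {y : L2 Γ (L2 Γ H) →L[ℂ] L2 Γ (L2 Γ H)}
    (h₁ : diagonalCoaction Γ H y = amp Γ _ y) (h₂ : deformedCoaction Γ H y = amp Γ _ y)
    {s t h k : Γ} (hne : ¬ (s = t ∧ h = k)) : entry h k (entry s t y) = 0 := by
  by_cases hhk : h = k
  · refine entry_eq_zero_of_conj_amp_eq (fun k h => h * k) h₁ fun h3 => hne ⟨?_, hhk⟩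
    subst hhk
    exact (mul_left_cancel h3).symm
  · exact entry_eq_zero_of_conj_amp_eq (fun _ h => h) h₂ fun h3 => hhk h3.symm

lemma eq_midAmp_of_fixed {y : L2 Γ (L2 Γ H) →L[ℂ] L2 Γ (L2 Γ H)}
    (h₁ : diagonalCoaction Γ H y = amp Γ _ y) (h₂ : deformedCoaction Γ H y = amp Γ _ y)
    {x : H →L[ℂ] H} (hx : ∀ s h, entry h h (entry s s y) = x) : y = midAmp Γ H x := by
  classical
  refine eq_of_entry_eq fun s t => eq_of_entry_eq fun h k => ?_
  rw [midAmp, StarAlgHom.comp_apply, entry_amp]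
  by_cases hne : s = t ∧ h = k
  · obtain ⟨rfl, rfl⟩ := hne
    rw [hx, if_pos rfl, entry_amp, if_pos rfl]
  · rw [entry_eq_zero_of_fixed h₁ h₂ hne]
    split_ifs with hst
    · rw [entry_amp, if_neg fun hhk => hne ⟨hst, hhk⟩]
    · rfl

end Shift

/-! ### Continuous linear maps on closed spans -/

section ClosedSpan

variable {I Γ K E : Type*} [Group Γ] [NormedAddCommGroup K] [InnerProductSpace ℂ K]
  [NormedAddCommGroup E] [NormedSpace ℂ E] {ω : Γ → Γ → Circle}

/-- The matrix entry `(s, t)` of an operator as a linear map. -/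
def entryLM (s t : I) : (L2 I K →L[ℂ] L2 I K) →ₗ[ℂ] (K →L[ℂ] K) where
  toFun := entry s t
  map_add' := entry_add s t
  map_smul' := entry_smul s t

lemma map_mem_of_mem_closedSpan {F : Type*} [NormedAddCommGroup F] [NormedSpace ℂ F] {S : Set F}
    {P : Submodule ℂ E} (hP : IsClosed (P : Set E)) (T : F →ₗ[ℂ] E) (hT : Continuous T)
    (h : ∀ x ∈ S, T x ∈ P) {y : F} (hy : y ∈ (Submodule.span ℂ S).topologicalClosure) :
    T y ∈ P :=
  Submodule.topologicalClosure_minimal _ (t := P.comap T) (Submodule.span_le.2 h)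
    (hP.preimage hT) hy

lemma map_mem_of_mem_twistedGroupAlg {P : Submodule ℂ E} (hP : IsClosed (P : Set E))
    (T : (L2 Γ K →L[ℂ] L2 Γ K) →ₗ[ℂ] E) (hT : Continuous T) (h : ∀ g, T (lamOp ω g) ∈ P)
    {y : L2 Γ K →L[ℂ] L2 Γ K} (hy : y ∈ twistedGroupAlg ω K) : T y ∈ P :=
  map_mem_of_mem_closedSpan hP T hT (by rintro _ ⟨g, rfl⟩; exact h g) hy

lemma lamOp_mem (g : Γ) : lamOp ω g ∈ twistedGroupAlg ω K :=
  Submodule.le_topologicalClosure _ (Submodule.subset_span ⟨g, rfl⟩)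

end ClosedSpan

/-! ### Spectral subspaces of a coaction -/

section Fibers

open scoped CStarAlgebra

variable {Γ A H : Type*} [Group Γ] [NonUnitalCStarAlgebra A]
  [NormedAddCommGroup H] [InnerProductSpace ℂ H] [CompleteSpace H] {π : A →⋆ₙₐ[ℂ] (H →L[ℂ] H)}

lemma map_mem_of_mem_reducedTensor {E : Type*} [NormedAddCommGroup E] [NormedSpace ℂ E]
    {P : Submodule ℂ E} (hP : IsClosed (P : Set E))
    (T : (L2 Γ H →L[ℂ] L2 Γ H) →ₗ[ℂ] E) (hT : Continuous T)
    (h : ∀ g a, T (lamOp 1 g * amp Γ H (π a)) ∈ P)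
    {y : L2 Γ H →L[ℂ] L2 Γ H} (hy : y ∈ reducedTensor Γ π) : T y ∈ P := by
  refine map_mem_of_mem_closedSpan hP T hT ?_ hy
  rintro _ ⟨y, hy, a, rfl⟩
  exact map_mem_of_mem_twistedGroupAlg hP (T ∘ₗ LinearMap.mulRight ℂ (amp Γ H (π a)))
    (hT.comp (continuous_mul_const _)) (fun g => h g a) hy

/-- By linearity and continuity it suffices to take `x = λ_g ⊗ a`, sent to `λ_g ⊗ λ_g ⊗ a`. The `(s,
t)` entry of either side vanishes unless `g = s t⁻¹`, and is then `λ_g ⊗ a`. -/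
lemma entry_comul {x : L2 Γ H →L[ℂ] L2 Γ H} (hx : x ∈ reducedTensor Γ π) (s t : Γ) :
    entry s t (comul Γ H x) = lamOp 1 (s * t⁻¹) * amp Γ H (entry s t x) := by
  classical
  let T₁ : (L2 Γ H →L[ℂ] L2 Γ H) →ₗ[ℂ] (L2 Γ H →L[ℂ] L2 Γ H) :=
    entryLM s t ∘ₗ (comul Γ H).toAlgHom.toLinearMap
  let T₂ : (L2 Γ H →L[ℂ] L2 Γ H) →ₗ[ℂ] (L2 Γ H →L[ℂ] L2 Γ H) :=
    LinearMap.mulLeft ℂ (lamOp 1 (s * t⁻¹)) ∘ₗ (amp Γ H).toAlgHom.toLinearMap ∘ₗ entryLM s t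
  have h1 : Continuous T₁ := (continuous_entry s t).comp (map_continuous (comul Γ H))
  have h2 : Continuous T₂ :=
    (continuous_const_mul _).comp ((map_continuous (amp Γ H)).comp (continuous_entry s t))
  have key : (T₁ - T₂) x ∈ (⊥ : Submodule ℂ (L2 Γ H →L[ℂ] L2 Γ H)) := by
    refine map_mem_of_mem_reducedTensor (π := π) (by simp) _ (h1.sub h2) (fun g a => ?_) hx
    rw [Submodule.mem_bot, LinearMap.sub_apply, sub_eq_zero]
    change entry s t (comul Γ H (lamOp 1 g * amp Γ H (π a))) =
      lamOp 1 (s * t⁻¹) * amp Γ H (entry s t (lamOp 1 g * amp Γ H (π a)))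
    ext1 η
    refine L2.ext fun h => ?_
    have h0 : ∀ v, (0 : L2 Γ H) v = 0 := fun _ => rfl
    simp only [entry_apply, comul_apply, mul_apply_eq_comp, lamOp_apply, amp_apply,
      controlled_symm_apply, single_apply, id]
    have h3 : g⁻¹ * h * (h⁻¹ * s) = g⁻¹ * s := by group
    rw [h3]
    by_cases hst : g⁻¹ * s = t
    · subst hst
      have h4 : (s * (g⁻¹ * s)⁻¹)⁻¹ * h = g⁻¹ * h := by group
      rw [h4]
      simp
    · simp [hst, h0]
  exact sub_eq_zero.1 ((Submodule.mem_bot _).1 key)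

variable (α : Coaction Γ π)

/-- Matrix entries of `α(x)` play the role of Fourier coefficients: coassociativity together with
`entry_comul` makes each of them homogeneous. -/
lemma Coaction.exists_fiber_entry (x : A) (s t : Γ) :
    ∃ y ∈ α.fiber (s * t⁻¹), π y = entry s t (α.toHom x) := by
  obtain ⟨y, h1, h2⟩ := α.coassoc x s t
  refine ⟨y, ?_, h1⟩
  rw [entry_comul (α.mem_tensor x), ← h1] at h2
  exact h2

variable {α}

lemma Coaction.toHom_fiber {g : Γ} {a : A} (ha : a ∈ α.fiber g) :
    α.toHom a = lamOp 1 g * amp Γ H (π a) := ha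

lemma Coaction.mul_mem_fiber {g h : Γ} {a b : A} (ha : a ∈ α.fiber g) (hb : b ∈ α.fiber h) :
    a * b ∈ α.fiber (g * h) := by
  change α.toHom (a * b) = lamOp 1 (g * h) * amp Γ H (π (a * b))
  rw [map_mul, toHom_fiber ha, toHom_fiber hb, map_mul, map_mul, ← lamOp_one_mul, mul_assoc,
    ← mul_assoc (amp Γ H (π a)), ← lamOp_amp_comm]
  simp only [mul_assoc]

lemma Coaction.star_mem_fiber {g : Γ} {a : A} (ha : a ∈ α.fiber g) : star a ∈ α.fiber g⁻¹ := by
  change α.toHom (star a) = lamOp 1 g⁻¹ * amp Γ H (π (star a))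
  rw [map_star, toHom_fiber ha, star_mul, star_lamOp_one, map_star π,
    ← map_star (amp Γ H), lamOp_amp_comm]

lemma Coaction.isClosed_fiber (g : Γ) : IsClosed (α.fiber g : Set A) :=
  isClosed_eq (map_continuous α.toHom)
    (continuous_const.mul ((map_continuous (amp Γ H)).comp (map_continuous π)))

variable (α)

/-- By the cancellation condition `1 ⊗ a` is a limit of combinations of `(λ_k ⊗ 1) α(b)`. The `(1,
1)` entry of such a product is the `(k⁻¹, 1)` entry of `α(b)`, hence lies in `π(A_{k⁻¹})`, while
that of `1 ⊗ a` is `π(a)`. -/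
lemma Coaction.dense_fibers (hπ : Function.Injective π) (a : A) :
    a ∈ (Submodule.span ℂ {x | ∃ g, x ∈ α.fiber g}).topologicalClosure := by
  set S := (Submodule.span ℂ {x | ∃ g, x ∈ α.fiber g}).topologicalClosure with hS
  -- An injective `π` is isometric, so it maps closed subspaces of the complete space `A` to closed
  -- subspaces.
  have hcl : IsClosed ((S.map (π : A →ₗ[ℂ] (H →L[ℂ] H)) : Submodule ℂ (H →L[ℂ] H)) : Set (H →L[ℂ] H)) := by
    rw [Submodule.map_coe]
    exact (NonUnitalStarAlgHom.isometry π hπ).isClosedEmbedding.isClosedMap _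
      (Submodule.isClosed_topologicalClosure _)
  have h1 : amp Γ H (π a) ∈ reducedTensor Γ π :=
    Submodule.le_topologicalClosure _ (Submodule.subset_span
      ⟨1, by simpa [lamOp_one isTwoCocycle_one] using lamOp_mem (K := H) (ω := 1) (1 : Γ), a,
        by simp⟩)
  rw [← α.cancellation] at h1
  have h2 : entryLM 1 1 (amp Γ H (π a)) ∈ S.map (π : A →ₗ[ℂ] (H →L[ℂ] H)) := by
    refine map_mem_of_mem_closedSpan hcl _ (continuous_entry 1 1) ?_ h1
    rintro _ ⟨y, hy, b, rfl⟩
    refine map_mem_of_mem_twistedGroupAlg hcl (entryLM 1 1 ∘ₗ LinearMap.mulRight ℂ (α.toHom b))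
      ((continuous_entry 1 1).comp (continuous_mul_const _)) (fun k => ?_) hy
    obtain ⟨y, hy, h3⟩ := α.exists_fiber_entry b k⁻¹ 1
    refine ⟨y, Submodule.le_topologicalClosure _ (Submodule.subset_span ⟨_, hy⟩), ?_⟩
    change π y = entry 1 1 (lamOp 1 k * α.toHom b)
    rw [h3]
    ext1 ξ
    simp [entry_apply, lamOp_apply]
  classical
  obtain ⟨b, hb, h4⟩ := h2
  have h5 : π b = π a := by
    rw [← show entry 1 1 (amp Γ H (π a)) = π a by rw [entry_amp, if_pos rfl]]
    exact h4
  exact hπ h5 ▸ hb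

/-! ### Homogeneous operators in the braided tensor product and the deformed fibres -/

variable {ω : Γ → Γ → Circle}

/-- The operators `α(b)_{12} Ãd(λ^(ω)_k)_{13}` for `b` in a spectral subspace `A_g`. They form a
`*`-semigroup. -/
def Coaction.homogeneous (hω : IsTwoCocycle ω) :
    Subsemigroup (L2 Γ (L2 Γ H) →L[ℂ] L2 Γ (L2 Γ H)) where
  carrier := {z | ∃ g k, ∃ b ∈ α.fiber g, z = midAmp Γ H (π b) * shiftOp ω H g k}
  mul_mem' := by
    rintro _ _ ⟨g, k, b, hb, rfl⟩ ⟨g', k', b', hb', rfl⟩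
    obtain ⟨c, hc⟩ := shiftOp_mul (H := H) hω g k g' k'
    refine ⟨g * g', g'⁻¹ * k * g' * k', c • (b * b'), Submodule.smul_mem _ c (mul_mem_fiber hb hb'), ?_⟩
    rw [mul_assoc, ← mul_assoc (shiftOp ω H g k), shiftOp_comm, mul_assoc, hc, ← mul_assoc,
      ← map_mul, ← map_mul, map_smul, map_smul, smul_mul_assoc, mul_smul_comm]

lemma Coaction.star_mem_homogeneous (hω : IsTwoCocycle ω)
    {z : L2 Γ (L2 Γ H) →L[ℂ] L2 Γ (L2 Γ H)} (hz : z ∈ α.homogeneous hω) :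
    star z ∈ α.homogeneous hω := by
  obtain ⟨g, k, b, hb, rfl⟩ := hz
  obtain ⟨c, hc⟩ := star_shiftOp (H := H) hω g k
  refine ⟨g⁻¹, g * k⁻¹ * g⁻¹, c • star b, Submodule.smul_mem _ c (star_mem_fiber hb), ?_⟩
  rw [star_mul, ← map_star, star_shiftOp_comm, hc, ← map_star, map_smul, map_smul,
    smul_mul_assoc, mul_smul_comm]

/-- Homogeneous operators form a semigroup closed under adjoints, so their linear span is already a
`*`-algebra. A generator `α(a)_{12} Ãd(x)_{13}` lies in its closure: approximate `a` by sums of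
elements of the fibres and `x` by combinations of the `λ_k`. -/
lemma Coaction.braided_le (hπ : Function.Injective π) (hω : IsTwoCocycle ω)
    {x : L2 Γ (L2 Γ H) →L[ℂ] L2 Γ (L2 Γ H)} (hx : x ∈ α.braided ω) :
    x ∈ (Submodule.span ℂ (α.homogeneous hω : Set _)).topologicalClosure := by
  set M := NonUnitalStarAlgebra.adjoin ℂ
    (α.homogeneous hω : Set (L2 Γ (L2 Γ H) →L[ℂ] L2 Γ (L2 Γ H))) with hM
  have hspan : M.toSubmodule = Submodule.span ℂ (α.homogeneous hω : Set _) := by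
    have h1 : (α.homogeneous hω : Set (L2 Γ (L2 Γ H) →L[ℂ] L2 Γ (L2 Γ H))) ∪
        star (α.homogeneous hω : Set (L2 Γ (L2 Γ H) →L[ℂ] L2 Γ (L2 Γ H))) =
        α.homogeneous hω := by
      refine Set.union_eq_left.2 fun z hz => ?_
      simpa using α.star_mem_homogeneous hω hz
    rw [hM, NonUnitalStarAlgebra.adjoin_eq_span, h1, Subsemigroup.closure_eq]
  rw [← hspan]
  refine NonUnitalStarSubalgebra.topologicalClosure_minimal _ (t := M.topologicalClosure)
    (NonUnitalStarAlgebra.adjoin_le ?_) (NonUnitalStarSubalgebra.isClosed_topologicalClosure _) hx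
  rintro _ ⟨a, x, hx, rfl⟩
  change _ ∈ M.toSubmodule.topologicalClosure
  have hcl := Submodule.isClosed_topologicalClosure M.toSubmodule
  let T : A →ₗ[ℂ] (L2 Γ (L2 Γ H) →L[ℂ] L2 Γ (L2 Γ H)) :=
    LinearMap.mulRight ℂ (adTilde ω H x) ∘ₗ (amp Γ (L2 Γ H)).toAlgHom.toLinearMap ∘ₗ
      (α.toHom : A →ₗ[ℂ] _)
  have hT : Continuous T := (continuous_mul_const _).comp
    ((map_continuous (amp Γ (L2 Γ H))).comp (map_continuous α.toHom))
  refine map_mem_of_mem_closedSpan hcl T hT ?_ (α.dense_fibers hπ a)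
  rintro b ⟨g, hb⟩
  refine map_mem_of_mem_twistedGroupAlg hcl
    (LinearMap.mulLeft ℂ (amp Γ (L2 Γ H) (α.toHom b)) ∘ₗ (adTilde ω H).toAlgHom.toLinearMap)
    ((continuous_const_mul _).comp (map_continuous (adTilde ω H))) (fun k => ?_) hx
  refine Submodule.le_topologicalClosure _ ?_
  rw [hspan]
  refine Submodule.subset_span ⟨g, k, b, hb, ?_⟩
  change amp Γ (L2 Γ H) (α.toHom b) * adTilde ω H (lamOp ω k) = _
  rw [toHom_fiber hb, lamOp_amp_comm, map_mul, mul_assoc]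
  rfl

lemma Coaction.exists_fiber_of_mem_deformedFiber (hπ : Function.Injective π)
    (hω : IsTwoCocycle ω) {g : Γ} {x : L2 Γ (L2 Γ H) →L[ℂ] L2 Γ (L2 Γ H)}
    (hx : x ∈ α.deformedFiber ω g) :
    ∃ b ∈ α.fiber g, midAmp Γ H (π b) * shiftOp ω⁻¹ H g g⁻¹ = x := by
  obtain ⟨⟨hbr, hdiag⟩, hdef⟩ := hx
  replace hdiag : diagonalCoaction Γ H x = amp Γ _ x := hdiag
  set V := shiftOp ω⁻¹ H g g⁻¹ with hV
  -- `E s h z` is the diagonal entry of `z V*` at position `s` of leg 3 and `h` of leg 1. On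
  -- homogeneous operators it acts as a projection to the component with `g' = g`, `k = g⁻¹`,
  -- independently of `s` and `h`; both facts pass to the closed span.
  let E (s h : Γ) : (L2 Γ (L2 Γ H) →L[ℂ] L2 Γ (L2 Γ H)) →ₗ[ℂ] (H →L[ℂ] H) :=
    entryLM h h ∘ₗ entryLM s s ∘ₗ LinearMap.mulRight ℂ (star V)
  have hE (s h : Γ) : Continuous (E s h) :=
    (continuous_entry h h).comp ((continuous_entry s s).comp (continuous_mul_const _))
  have hhom : ∀ z ∈ α.homogeneous hω.inv, ∃ b ∈ α.fiber g, ∀ s h, E s h z = π b := by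
    rintro _ ⟨g', k, b, hb, rfl⟩
    have h1 : ∀ s h, E s h (midAmp Γ H (π b) * shiftOp ω⁻¹ H g' k) =
        π b * entry h h (entry s s (shiftOp ω⁻¹ H g' k * star V)) := fun s h => by
      rw [← entry_midAmp_mul, ← mul_assoc]
      rfl
    by_cases hgk : g' = g ∧ k = g⁻¹
    · obtain ⟨rfl, rfl⟩ := hgk
      refine ⟨b, hb, fun s h => ?_⟩
      classical
      rw [h1, hV, shiftOp_mul_star_self hω.inv, ← entry_midAmp_mul, mul_one, midAmp,
        StarAlgHom.comp_apply, entry_amp, if_pos rfl, entry_amp, if_pos rfl]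
    · refine ⟨0, Submodule.zero_mem _, fun s h => ?_⟩
      rw [h1, hV, entry_shiftOp_mul_star hω.inv _ _ _ _ _ _ hgk, mul_zero, map_zero]
  have hx' := α.braided_le hπ hω.inv hbr
  have hconst : ∀ s h, E s h x = E 1 1 x := fun s h => by
    refine sub_eq_zero.1 ((Submodule.mem_bot ℂ).1 (map_mem_of_mem_closedSpan
      (T := E s h - E 1 1) (by simp) ((hE s h).sub (hE 1 1)) (fun z hz => ?_) hx'))
    obtain ⟨b, -, hb⟩ := hhom z hz
    simp [hb]
  have hcl : IsClosed (((α.fiber g).map (π : A →ₗ[ℂ] (H →L[ℂ] H)) : Submodule ℂ (H →L[ℂ] H)) :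
      Set (H →L[ℂ] H)) := by
    rw [Submodule.map_coe]
    exact (NonUnitalStarAlgHom.isometry π hπ).isClosedEmbedding.isClosedMap _ (isClosed_fiber g)
  obtain ⟨b, hb, hbx⟩ : E 1 1 x ∈ (α.fiber g).map (π : A →ₗ[ℂ] (H →L[ℂ] H)) := by
    refine map_mem_of_mem_closedSpan hcl _ (hE 1 1) (fun z hz => ?_) hx'
    obtain ⟨b, hb, hbz⟩ := hhom z hz
    exact ⟨b, hb, (hbz 1 1).symm⟩
  refine ⟨b, hb, ?_⟩
  have hy : x * star V = midAmp Γ H (π b) := by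
    refine eq_midAmp_of_fixed ?_ ?_ fun s h => (hconst s h).trans hbx.symm
    · rw [map_mul, map_star, hdiag, hV, diagonalCoaction_shiftOp, ← map_star, ← map_mul]
    -- Both `x` and `V` have degree `g` under the deformed coaction, so the factors `λ_g` and
    -- `λ_{g⁻¹}` cancel in `x V*`.
    · rw [map_mul, map_star, hdef, hV, deformedCoaction_shiftOp, star_mul, star_lamOp_one,
        ← map_star, lamOp_amp_comm, mul_assoc, ← mul_assoc (lamOp 1 g),
        lamOp_amp_comm, mul_assoc, lamOp_one_mul, mul_inv_cancel, lamOp_one isTwoCocycle_one,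
        mul_one, ← map_mul]
  rw [← hy, mul_assoc, hV, star_shiftOp_mul_self, mul_one]

lemma Coaction.mem_deformedFiber {g : Γ} {b : A} (hb : b ∈ α.fiber g) :
    midAmp Γ H (π b) * shiftOp ω⁻¹ H g g⁻¹ ∈ α.deformedFiber ω g := by
  refine ⟨⟨?_, ?_⟩, ?_⟩
  · refine NonUnitalStarSubalgebra.le_topologicalClosure _
      (NonUnitalStarAlgebra.subset_adjoin ℂ _ ⟨b, lamOp ω⁻¹ g⁻¹, lamOp_mem _, ?_⟩)
    rw [toHom_fiber hb, lamOp_amp_comm, map_mul, mul_assoc]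
    rfl
  · change diagonalCoaction Γ H _ = amp Γ _ _
    rw [map_mul, diagonalCoaction_midAmp, diagonalCoaction_shiftOp, ← map_mul]
  · rw [map_mul, deformedCoaction_midAmp, deformedCoaction_shiftOp, ← mul_assoc,
      ← lamOp_amp_comm, mul_assoc, ← map_mul]

end Fibers

/-! ### Transfer of approximating nets along isometries of fibres -/

lemma _root_.LinearIsometry.summable_comp_iff {I E F : Type*} [NormedAddCommGroup E]
    [NormedSpace ℂ E] [CompleteSpace E] [NormedAddCommGroup F] [NormedSpace ℂ F]
    [CompleteSpace F] (φ : E →ₗᵢ[ℂ] F) (f : I → E) : Summable (fun i => φ (f i)) ↔ Summable f := by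
  refine ⟨fun h => ?_, fun h => h.map φ φ.continuous⟩
  rw [summable_iff_cauchySeq_finset]
  -- An isometry reflects the Cauchy property of the finite partial sums, and `E` is complete.
  refine φ.isometry.isUniformInducing.cauchy_map_iff.1 ?_
  rw [Filter.map_map]
  have h1 : (φ ∘ fun s : Finset I => ∑ i ∈ s, f i) = fun s => ∑ i ∈ s, φ (f i) :=
    funext fun s => map_sum φ f s
  rw [h1]
  exact (summable_iff_cauchySeq_finset (f := fun i => φ (f i))).1 h

lemma _root_.LinearIsometry.map_tsum {I E F : Type*} [NormedAddCommGroup E]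
    [NormedSpace ℂ E] [NormedAddCommGroup F] [NormedSpace ℂ F]
    (φ : E →ₗᵢ[ℂ] F) {f : I → E} (hf : Summable f) : ∑' i, φ (f i) = φ (∑' i, f i) :=
  (φ.toContinuousLinearMap.map_tsum hf).symm

section Transfer

variable {Γ D D' : Type*} [Group Γ] [NonUnitalCStarAlgebra D] [NonUnitalCStarAlgebra D']
  {B : Γ → Submodule ℂ D} {B' : Γ → Submodule ℂ D'} {φ : Γ → D →ₗᵢ[ℂ] D'}

/-- Approximating nets transfer along isometric isomorphisms of bundles that respect the bimodule
structure over the unit fibers. -/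
lemma isApproximating_iff (hB : ∀ g, B' g = (B g).map (φ g).toLinearMap)
    (hstar : ∀ a b, star (φ 1 a) * φ 1 b = φ 1 (star a * b))
    (hmul : ∀ g a b c, star (φ 1 a) * φ g b * φ 1 c = φ g (star a * b * c))
    {ι : Type*} [Preorder ι] (a : ι → Γ → D) :
    IsApproximating B' (fun i g => φ 1 (a i g)) ↔ IsApproximating B a := by
  have hmem : ∀ g x, φ g x ∈ B' g ↔ x ∈ B g := fun g x => by
    rw [hB]
    exact (φ g).injective.mem_set_image
  constructor
  · intro h
    have hs : ∀ i, Summable fun g => star (a i g) * a i g := fun i => by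
      simpa only [hstar, LinearIsometry.summable_comp_iff] using h.summable i
    have hc : ∀ g, ∀ b ∈ B g, ∀ i, Summable fun h => star (a i (g * h)) * b * a i h :=
      fun g b hb i => by
        simpa only [hmul, LinearIsometry.summable_comp_iff] using
          h.summable_conj g _ ((hmem g b).2 hb) i
    refine ⟨fun i g => (hmem _ _).1 (h.mem i g), hs, ?_, hc, fun g b hb => ?_⟩
    · obtain ⟨M, hM⟩ := h.bounded
      refine ⟨M, fun i => ?_⟩
      simpa only [hstar, LinearIsometry.map_tsum _ (hs i), LinearIsometry.norm_map] using hM i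
    · have := h.tendsto g _ ((hmem g b).2 hb)
      simp only [hmul, LinearIsometry.map_tsum _ (hc g b hb _)] at this
      exact (φ g).isometry.isEmbedding.tendsto_nhds_iff.2 this
  · intro h
    have hs : ∀ i, ∑' g, star (φ 1 (a i g)) * φ 1 (a i g) =
        φ 1 (∑' g, star (a i g) * a i g) := fun i => by
      simp only [hstar, LinearIsometry.map_tsum _ (h.summable i)]
    refine ⟨fun i g => (hmem _ _).2 (h.mem i g), fun i => ?_, ?_, fun g b hb i => ?_,
      fun g b hb => ?_⟩
    · simpa only [hstar, LinearIsometry.summable_comp_iff] using h.summable i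
    · obtain ⟨M, hM⟩ := h.bounded
      exact ⟨M, fun i => by rw [hs, LinearIsometry.norm_map]; exact hM i⟩
    · rw [hB] at hb
      obtain ⟨b, hb, rfl⟩ := hb
      change Summable fun h => star (φ 1 (a i (g * h))) * φ g b * φ 1 (a i h)
      simpa only [hmul, LinearIsometry.summable_comp_iff] using h.summable_conj g b hb i
    · rw [hB] at hb
      obtain ⟨b, hb, rfl⟩ := hb
      change Tendsto (fun i => ∑' h, star (φ 1 (a i (g * h))) * φ g b * φ 1 (a i h)) atTop
        (𝓝 (φ g b))
      simp only [hmul, LinearIsometry.map_tsum _ (h.summable_conj g b hb _)]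
      exact ((φ g).continuous.tendsto b).comp (h.tendsto g b hb)

lemma exists_isApproximating_iff (hB : ∀ g, B' g = (B g).map (φ g).toLinearMap)
    (hstar : ∀ a b, star (φ 1 a) * φ 1 b = φ 1 (star a * b))
    (hmul : ∀ g a b c, star (φ 1 a) * φ g b * φ 1 c = φ g (star a * b * c))
    (ι : Type*) [Preorder ι] :
    (∃ a : ι → Γ → D, IsApproximating B a) ↔ ∃ a : ι → Γ → D', IsApproximating B' a := by
  refine ⟨fun ⟨a, ha⟩ => ⟨_, (isApproximating_iff hB hstar hmul a).2 ha⟩, fun ⟨a, ha⟩ => ?_⟩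
  -- A net for `B'` takes values in `B' 1`, the image of `B 1` under `φ 1`, so it lifts pointwise.
  have h1 : ∀ i g, ∃ x, φ 1 x = a i g := fun i g => by
    have := ha.mem i g
    rw [hB] at this
    obtain ⟨x, -, hx⟩ := this
    exact ⟨x, hx⟩
  choose a' ha' using h1
  obtain rfl : (fun i g => φ 1 (a' i g)) = a := funext₂ ha'
  exact ⟨a', (isApproximating_iff hB hstar hmul a').1 ha⟩

end Transfer

/-! ### The isometries from the fibres of `A` onto those of its deformation -/

section Deformation

variable {Γ A H : Type*} [Group Γ] [NonUnitalCStarAlgebra A]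
  [NormedAddCommGroup H] [InnerProductSpace ℂ H] [CompleteSpace H] {π : A →⋆ₙₐ[ℂ] (H →L[ℂ] H)}
  {ω : Γ → Γ → Circle}

/-- The isometry `b ↦ (λ_g ⊗ b)_{12} Ãd(λ^(ω̄)_{g⁻¹})_{13}`, which maps `A_g` onto `(A_ω)_g`. -/
def fiberIsometry (hπ : Function.Injective π) (hω : IsTwoCocycle ω) (g : Γ) :
    A →ₗᵢ[ℂ] (L2 Γ (L2 Γ H) →L[ℂ] L2 Γ (L2 Γ H)) where
  toFun b := midAmp Γ H (π b) * shiftOp ω⁻¹ H g g⁻¹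
  map_add' a b := by simp only [map_add, add_mul]
  map_smul' c b := by simp only [map_smul, smul_mul_assoc, RingHom.id_apply]
  norm_map' b := (norm_midAmp_mul_shiftOp hω.inv (π b) g g⁻¹).trans
    (NonUnitalStarAlgHom.norm_map π hπ b)

lemma fiberIsometry_apply (hπ : Function.Injective π) (hω : IsTwoCocycle ω) (g : Γ) (b : A) :
    fiberIsometry hπ hω g b = midAmp Γ H (π b) * shiftOp ω⁻¹ H g g⁻¹ := rfl

lemma fiberIsometry_one (hπ : Function.Injective π) (hω : IsTwoCocycle ω) (b : A) :
    fiberIsometry hπ hω (1 : Γ) b = midAmp Γ H (π b) := by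
  rw [fiberIsometry_apply, inv_one, shiftOp_one hω.inv, mul_one]

lemma Coaction.deformedFiber_eq_map (α : Coaction Γ π) (hπ : Function.Injective π)
    (hω : IsTwoCocycle ω) (g : Γ) :
    α.deformedFiber ω g = (α.fiber g).map (fiberIsometry hπ hω g).toLinearMap := by
  refine le_antisymm (fun x hx => α.exists_fiber_of_mem_deformedFiber hπ hω hx) ?_
  rintro _ ⟨b, hb, rfl⟩
  exact α.mem_deformedFiber hb

lemma Coaction.exists_isApproximating_deformedFiber_iff (α : Coaction Γ π)
    (hπ : Function.Injective π) (hω : IsTwoCocycle ω) (ι : Type*) [Preorder ι] :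
    (∃ a : ι → Γ → A, IsApproximating α.fiber a) ↔
      ∃ a : ι → Γ → (L2 Γ (L2 Γ H) →L[ℂ] L2 Γ (L2 Γ H)),
        IsApproximating (α.deformedFiber ω) a := by
  refine exists_isApproximating_iff (α.deformedFiber_eq_map hπ hω) (fun a b => ?_)
    (fun g a b c => ?_) ι
  · simp only [fiberIsometry_one, map_mul, map_star]
  -- The unitary attached to `g` commutes with `π(c)_2`, so it can be moved to the far right without
  -- producing a phase.
  · rw [fiberIsometry_one, fiberIsometry_one, fiberIsometry_apply, fiberIsometry_apply, mul_assoc,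
      mul_assoc, shiftOp_comm]
    simp only [map_mul, map_star, mul_assoc]

end Deformation

end FellDeformation

end

theorem mainTheorem10 {Γ : Type u} [Group Γ] {ω : Γ → Γ → Circle}
    (hω : IsTwoCocycle ω) {A : Type v} [NonUnitalCStarAlgebra A] {H : Type x}
    [NormedAddCommGroup H] [InnerProductSpace ℂ H] [CompleteSpace H]
    (π : A →⋆ₙₐ[ℂ] (H →L[ℂ] H)) (hπ : Function.Injective π) (α : Coaction Γ π) :
    (HasApproximationProperty.{w} α.fiber ↔
      HasApproximationProperty.{w} (α.deformedFiber ω)) ∧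
    (HasSequentialApproximationProperty α.fiber ↔
      HasSequentialApproximationProperty (α.deformedFiber ω)) := by
  refine ⟨?_, α.exists_isApproximating_deformedFiber_iff hπ hω ℕ⟩
  exact exists_congr fun ι => exists_congr fun _ => exists_congr fun _ => exists_congr fun _ =>
    α.exists_isApproximating_deformedFiber_iff hπ hω ι
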